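/- All graphs are finite and simple. An edge-labeling of a graph $G=(V,E)$ is a map $\ell:E\to\{N,F\}$ (near/far). A weak unit interval representation of $G$ with respect to $\ell$ is a map $I:V\to\mathbb{R}$ such that for every edge $uv\in E$ one has $|I(u)-I(v)|\le 1$ if and only if $\ell(uv)=N$. The graph $G$ is a weak unit interval graph if it has a weak unit interval representation with respect to every edge-labeling $\ell$. The maximum average degree $\operatorname{mad}(G)$ is the maximum, over all nonempty subgraphs $H$ of $G$, of the average vertex degree $\frac{1}{|V(H)|}\sum_{v\in V(H)}\deg_H(v)$ (and $\operatorname{mad}(G)=0$ if $G$ has no vertices). Theorem. Every planar graph $G$ with $\operatorname{mad}(G)<\frac{26}{11}$ is a weak unit interval graph. -/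

import Mathlib

namespace SimpleGraph

/-- A plane drawing of a simple graph without crossings: vertices are distinct points of the
Euclidean plane, every edge is a simple arc (an injective continuous image of `[0, 1]`) joining the
points of its two ends, the interior of an arc contains no vertex, and the interiors of two
different arcs are disjoint. -/
structure PlaneEmbedding {V : Type*} (G : SimpleGraph V) where
  /-- the point representing a vertex -/
  point : V → EuclideanSpace ℝ (Fin 2)
  /-- the arc representing an edge -/
  arc : G.edgeSet → unitInterval → EuclideanSpace ℝ (Fin 2)
  point_injective : Function.Injective point
  arc_continuous : ∀ e, Continuous (arc e)
  arc_injective : ∀ e, Function.Injective (arc e)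
  arc_ends : ∀ e : G.edgeSet, s(arc e 0, arc e 1) = Sym2.map point (e : Sym2 V)
  arc_ne_point : ∀ e, ∀ t ∈ Set.Ioo (0 : unitInterval) 1, ∀ v, arc e t ≠ point v
  arc_ne_arc : ∀ e e', e ≠ e' → ∀ t ∈ Set.Ioo (0 : unitInterval) 1,
    ∀ t' ∈ Set.Ioo (0 : unitInterval) 1, arc e t ≠ arc e' t'

/-- A graph is planar if it has a crossing-free drawing in the Euclidean plane. -/
def IsPlanar {V : Type*} (G : SimpleGraph V) : Prop :=
  Nonempty G.PlaneEmbedding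

/-- The average vertex degree of a subgraph of a finite graph (each degree is taken in the
subgraph). -/
noncomputable def Subgraph.averageDegree {V : Type*} [Finite V] {G : SimpleGraph V}
    (H : G.Subgraph) : ℝ :=
  (∑ᶠ v : H.verts, ((H.neighborSet v).ncard : ℝ)) / (H.verts.ncard : ℝ)

/-- The maximum average degree `mad(G)` of a finite graph: the largest average vertex degree of a
nonempty subgraph (and `0` for the graph without vertices). The set is finite, so the supremum is
a maximum as soon as `G` has a vertex. -/
noncomputable def maximumAverageDegree {V : Type*} [Finite V] (G : SimpleGraph V) : ℝ :=
  sSup {a : ℝ | ∃ H : G.Subgraph, H.verts.Nonempty ∧ H.averageDegree = a}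

/-- The two labels of an edge. -/
inductive NearFar
  | near
  | far

/-- `I` (the centres of intervals of diameter `1`) is a weak unit interval representation of `G`
with respect to the edge-labeling `ℓ`: the intervals of two adjacent vertices intersect if and only
if the edge is labeled near. -/
def IsWeakUnitIntervalRep {V : Type*} (G : SimpleGraph V) (ℓ : G.EdgeLabeling NearFar)
    (I : V → ℝ) : Prop :=
  ∀ (u v : V) (h : G.Adj u v), |I u - I v| ≤ 1 ↔ ℓ.get u v h = NearFar.near

/-- A graph is a weak unit interval graph if it has a weak unit interval representation with
respect to every edge-labeling. -/
def IsWeakUnitIntervalGraph {V : Type*} (G : SimpleGraph V) : Prop :=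
  ∀ ℓ : G.EdgeLabeling NearFar, ∃ I : V → ℝ, G.IsWeakUnitIntervalRep ℓ I

end SimpleGraph

/-!
The proof exploits sparsity only through the weaker bound `12 / 5 > 26 / 11` on average degrees. The
idea is to look for representations whose values all lie in the window
`(-3/2, 3/2) \ {-1/2, 1/2}`. Inside this window two extension properties hold. From every position
there is a position at distance at most `1` and one at distance more than `1`
(`exists_mem_window_near_iff`), and for any two positions `p`, `q` and any three labels there are
positions `a`, `b` such that the pairs `(p, a)`, `(a, b)`, `(b, q)` realise the three labels
(`exists_mem_window_thread`). The length `3` of the window makes three near edges harmless, its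
openness is needed for the labels near, far, near, and the two points are omitted because the labels
far, near, far cannot be realised between them. Consequently a representation with values in the
window extends over a vertex of degree at most `1`, and over two adjacent vertices of degree at most
`2`.

One of these two configurations occurs in every nonempty induced subgraph
(`exists_leaf_or_adjacent_pair`): if all degrees are at least `2` and vertices of degree `2` are
pairwise nonadjacent, then with `m` vertices of degree `2`, `n` others and `D` the degree sum of the
latter, `D ≥ 2 m` and `D ≥ 3 n`, so that `5 (2 m + D) ≥ 12 (m + n)` and the average degree is at
least `12 / 5`. Induction on the vertex set concludes.
-/

namespace SimpleGraph

/-! ### Positions in the window -/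

/-- The window: the open interval `(-3/2, 3/2)` without the points `-1/2` and `1/2`. -/
def window : Set ℝ := {x | -3 / 2 < x ∧ x < 3 / 2 ∧ x ≠ -1 / 2 ∧ x ≠ 1 / 2}

lemma neg_mem_window {x : ℝ} (hx : x ∈ window) : -x ∈ window := by
  obtain ⟨h1, h2, h3, h4⟩ := hx
  refine ⟨by linarith, by linarith, fun h => h4 (by linarith), fun h => h3 (by linarith)⟩

lemma exists_far_right {p : ℝ} (hp : p ∈ window) (h : p < 1 / 2) : ∃ a ∈ window, 1 < a - p := by
  obtain ⟨h1, h2, h3, h4⟩ := hp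
  have hm : max p (-1 / 2) < 1 / 2 := max_lt h (by norm_num)
  have hl := le_max_left p (-1 / 2)
  have hr := le_max_right p (-1 / 2)
  exact ⟨(max p (-1 / 2) + 1 + 3 / 2) / 2,
    ⟨by linarith, by linarith, by linarith, by linarith⟩, by linarith⟩

lemma exists_mem_window_near_iff {p : ℝ} (hp : p ∈ window) (P : Prop) :
    ∃ a ∈ window, (|p - a| ≤ 1 ↔ P) := by
  by_cases hP : P
  · exact ⟨p, hp, by simp [hP]⟩
  simp only [hP, iff_false, not_le, lt_abs]
  rcases lt_or_ge p (1 / 2) with h | h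
  · obtain ⟨a, ha, h'⟩ := exists_far_right hp h
    exact ⟨a, ha, Or.inr (by linarith)⟩
  · obtain ⟨a, ha, h'⟩ := exists_far_right (neg_mem_window hp) (by linarith)
    exact ⟨-a, neg_mem_window ha, Or.inl (by linarith)⟩

lemma exists_near_near_near {p q : ℝ} (hp : p ∈ window) (hq : q ∈ window) :
    ∃ a ∈ window, ∃ b ∈ window, |p - a| ≤ 1 ∧ |a - b| ≤ 1 ∧ |b - q| ≤ 1 := by
  obtain ⟨hp1, hp2, -, -⟩ := hp
  obtain ⟨hq1, hq2, -, -⟩ := hq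
  refine ⟨p / 3, ⟨?_, ?_, ?_, ?_⟩, q / 3, ⟨?_, ?_, ?_, ?_⟩, abs_le.2 ⟨?_, ?_⟩, abs_le.2 ⟨?_, ?_⟩,
    abs_le.2 ⟨?_, ?_⟩⟩ <;> linarith

lemma exists_near_far_near {p q : ℝ} (hp : p ∈ window) (hq : q ∈ window) :
    ∃ a ∈ window, ∃ b ∈ window, |p - a| ≤ 1 ∧ 1 < |a - b| ∧ |b - q| ≤ 1 := by
  wlog hpq : p ≤ q generalizing p q
  · obtain ⟨a, ha, b, hb, h1, h2, h3⟩ := this hq hp (by linarith)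
    exact ⟨b, hb, a, ha, by rwa [abs_sub_comm], by rwa [abs_sub_comm], by rwa [abs_sub_comm]⟩
  obtain ⟨hp1, hp2, hp3, hp4⟩ := hp
  obtain ⟨hq1, hq2, hq3, hq4⟩ := hq
  rcases lt_or_gt_of_ne hp3 with h | h <;> rcases lt_or_gt_of_ne hq4 with h' | h'
  · -- `a` lies just above `-3/2` and below `q`
    have hl := min_le_left q (-1)
    have hr := min_le_right q (-1)
    have hm : -3 / 2 < min q (-1) := lt_min hq1 (by norm_num)
    refine ⟨(min q (-1) - 3 / 2) / 2, ⟨?_, ?_, ?_, ?_⟩, q + 1, ⟨?_, ?_, ?_, ?_⟩, abs_le.2 ⟨?_, ?_⟩,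
      lt_abs.2 (Or.inr ?_), abs_le.2 ⟨?_, ?_⟩⟩ <;>
      first | linarith | exact fun h => hq3 (by linarith)
  · refine ⟨-1, ⟨?_, ?_, ?_, ?_⟩, 1, ⟨?_, ?_, ?_, ?_⟩, abs_le.2 ⟨?_, ?_⟩,
      lt_abs.2 (Or.inr ?_), abs_le.2 ⟨?_, ?_⟩⟩ <;> linarith
  · refine ⟨p - 1, ⟨?_, ?_, ?_, ?_⟩, q + 1, ⟨?_, ?_, ?_, ?_⟩, abs_le.2 ⟨?_, ?_⟩,
      lt_abs.2 (Or.inr ?_), abs_le.2 ⟨?_, ?_⟩⟩ <;> linarith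
  · -- `b` lies just below `3/2` and above `p`
    have hl := le_max_left p 1
    have hr := le_max_right p 1
    have hm : max p 1 < 3 / 2 := max_lt hp2 (by norm_num)
    refine ⟨p - 1, ⟨?_, ?_, ?_, ?_⟩, (max p 1 + 3 / 2) / 2, ⟨?_, ?_, ?_, ?_⟩, abs_le.2 ⟨?_, ?_⟩,
      lt_abs.2 (Or.inr ?_), abs_le.2 ⟨?_, ?_⟩⟩ <;>
      first | linarith | exact fun h => hp4 (by linarith)

lemma exists_near_near_far {p q : ℝ} (hp : p ∈ window) (hq : q ∈ window) :
    ∃ a ∈ window, ∃ b ∈ window, |p - a| ≤ 1 ∧ |a - b| ≤ 1 ∧ 1 < |b - q| := by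
  obtain ⟨hp1, hp2, -, -⟩ := hp
  obtain ⟨hq1, hq2, hq3, hq4⟩ := hq
  rcases lt_or_gt_of_ne hq3 with h | h
  · refine ⟨p / 3, ⟨?_, ?_, ?_, ?_⟩, (q + 3 / 2) / 2, ⟨?_, ?_, ?_, ?_⟩, abs_le.2 ⟨?_, ?_⟩,
      abs_le.2 ⟨?_, ?_⟩, lt_abs.2 (Or.inl ?_)⟩ <;> linarith
  rcases lt_or_gt_of_ne hq4 with h' | h'
  · -- both far sides of `q` are available, and the one on the side of `p` is used
    rcases le_total 0 p with h0 | h0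
    · refine ⟨3 / 4, ⟨?_, ?_, ?_, ?_⟩, (q + 5 / 2) / 2, ⟨?_, ?_, ?_, ?_⟩, abs_le.2 ⟨?_, ?_⟩,
        abs_le.2 ⟨?_, ?_⟩, lt_abs.2 (Or.inl ?_)⟩ <;> linarith
    · refine ⟨-3 / 4, ⟨?_, ?_, ?_, ?_⟩, (q - 5 / 2) / 2, ⟨?_, ?_, ?_, ?_⟩, abs_le.2 ⟨?_, ?_⟩,
        abs_le.2 ⟨?_, ?_⟩, lt_abs.2 (Or.inr ?_)⟩ <;> linarith
  · refine ⟨p / 3, ⟨?_, ?_, ?_, ?_⟩, (q - 3 / 2) / 2, ⟨?_, ?_, ?_, ?_⟩, abs_le.2 ⟨?_, ?_⟩,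
      abs_le.2 ⟨?_, ?_⟩, lt_abs.2 (Or.inr ?_)⟩ <;> linarith

lemma exists_far_near_far {p q : ℝ} (hp : p ∈ window) (hq : q ∈ window) :
    ∃ a ∈ window, ∃ b ∈ window, 1 < |p - a| ∧ |a - b| ≤ 1 ∧ 1 < |b - q| := by
  wlog hpq : p ≤ q generalizing p q
  · obtain ⟨a, ha, b, hb, h1, h2, h3⟩ := this hq hp (by linarith)
    exact ⟨b, hb, a, ha, by rwa [abs_sub_comm], by rwa [abs_sub_comm], by rwa [abs_sub_comm]⟩
  -- if `p` and `q` have a common far side, then `a = b` works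
  rcases lt_or_ge q (1 / 2) with h | h
  · obtain ⟨a, ha, h'⟩ := exists_far_right hq h
    exact ⟨a, ha, a, ha, lt_abs.2 (Or.inr (by linarith)), by simp, lt_abs.2 (Or.inl (by linarith))⟩
  rcases lt_or_ge (-1 / 2) p with h' | h'
  · obtain ⟨a, ha, h''⟩ := exists_far_right (neg_mem_window hp) (by linarith)
    exact ⟨-a, neg_mem_window ha, -a, neg_mem_window ha, lt_abs.2 (Or.inl (by linarith)), by simp,
      lt_abs.2 (Or.inr (by linarith))⟩
  obtain ⟨hp1, hp2, hp3, hp4⟩ := hp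
  obtain ⟨hq1, hq2, hq3, hq4⟩ := hq
  have h := lt_of_le_of_ne h (Ne.symm hq4)
  have h' := lt_of_le_of_ne h' hp3
  refine ⟨(p + 3 / 2) / 2, ⟨?_, ?_, ?_, ?_⟩, (q - 3 / 2) / 2, ⟨?_, ?_, ?_, ?_⟩,
    lt_abs.2 (Or.inr ?_), abs_le.2 ⟨?_, ?_⟩, lt_abs.2 (Or.inr ?_)⟩ <;> linarith

/-- Two far steps from `p`, which lies to the left of `1/2`, reach everything to the left of
`1/2`: the first step goes close enough to `3/2`. -/
lemma exists_far_far {p b : ℝ} (hp : p ∈ window) (h : p < 1 / 2) (hb : b < 1 / 2) :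
    ∃ a ∈ window, 1 < |p - a| ∧ 1 < |a - b| := by
  obtain ⟨hp1, hp2, hp3, hp4⟩ := hp
  have hm : max (max p b) (-1 / 2) < 1 / 2 := max_lt (max_lt h hb) (by norm_num)
  have h1 := le_max_left (max p b) (-1 / 2)
  have h2 := le_max_right (max p b) (-1 / 2)
  have h3 := le_max_left p b
  have h4 := le_max_right p b
  exact ⟨(max (max p b) (-1 / 2) + 5 / 2) / 2,
    ⟨by linarith, by linarith, by linarith, by linarith⟩, lt_abs.2 (Or.inr (by linarith)),
    lt_abs.2 (Or.inl (by linarith))⟩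

lemma exists_far_far_iff {p q : ℝ} (hp : p ∈ window) (hq : q ∈ window) (P : Prop) :
    ∃ a ∈ window, ∃ b ∈ window, 1 < |p - a| ∧ 1 < |a - b| ∧ (|b - q| ≤ 1 ↔ P) := by
  wlog h : p < 1 / 2 generalizing p q
  · obtain ⟨a, ha, b, hb, h1, h2, h3⟩ :=
      this (neg_mem_window hp) (neg_mem_window hq) (by linarith)
    refine ⟨-a, neg_mem_window ha, -b, neg_mem_window hb, ?_, ?_, ?_⟩
    · rwa [show p - -a = -(-p - a) by ring, abs_neg]
    · rwa [show -a - -b = -(a - b) by ring, abs_neg]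
    · rwa [show -b - q = -(b - -q) by ring, abs_neg]
  -- it suffices to find `b` to the left of `1/2`
  suffices ∃ b ∈ window, b < 1 / 2 ∧ (|b - q| ≤ 1 ↔ P) by
    obtain ⟨b, hb, hb', hP⟩ := this
    obtain ⟨a, ha, h1, h2⟩ := exists_far_far hp h hb'
    exact ⟨a, ha, b, hb, h1, h2, hP⟩
  have hq' := hq
  obtain ⟨hq1, hq2, hq3, hq4⟩ := hq'
  by_cases hP : P
  · simp only [hP, iff_true]
    rcases lt_or_gt_of_ne hq4 with h' | h'
    · exact ⟨q, hq, h', by simp⟩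
    · exact ⟨q - 1, ⟨by linarith, by linarith, by linarith, by linarith⟩, by linarith,
        by simp⟩
  · simp only [hP, iff_false, not_le]
    rcases lt_or_gt_of_ne hq3 with h' | h'
    · exact ⟨(q + 3 / 2) / 2, ⟨by linarith, by linarith, by linarith, by linarith⟩, by linarith,
        lt_abs.2 (Or.inl (by linarith))⟩
    · obtain ⟨a, ha, h''⟩ := exists_far_right (neg_mem_window hq) (by linarith)
      exact ⟨-a, neg_mem_window ha, by linarith, lt_abs.2 (Or.inr (by linarith))⟩

/-- Any three labels can be realised along a path with three edges whose ends are prescribed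
positions in the window. -/
lemma exists_mem_window_thread {p q : ℝ} (hp : p ∈ window) (hq : q ∈ window) (P Q R : Prop) :
    ∃ a ∈ window, ∃ b ∈ window, (|p - a| ≤ 1 ↔ P) ∧ (|a - b| ≤ 1 ↔ Q) ∧ (|b - q| ≤ 1 ↔ R) := by
  by_cases hP : P <;> by_cases hQ : Q <;> by_cases hR : R <;>
    simp only [hP, hQ, hR, iff_true, iff_false, not_le]
  · exact exists_near_near_near hp hq
  · exact exists_near_near_far hp hq
  · exact exists_near_far_near hp hq
  · obtain ⟨a, ha, b, hb, h1, h2, h3⟩ := exists_far_far_iff hq hp True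
    simp only [iff_true] at h3
    exact ⟨b, hb, a, ha, by rwa [abs_sub_comm], by rwa [abs_sub_comm], by rwa [abs_sub_comm]⟩
  · obtain ⟨a, ha, b, hb, h1, h2, h3⟩ := exists_near_near_far hq hp
    exact ⟨b, hb, a, ha, by rwa [abs_sub_comm], by rwa [abs_sub_comm], by rwa [abs_sub_comm]⟩
  · exact exists_far_near_far hp hq
  · simpa using exists_far_far_iff hp hq True
  · simpa using exists_far_far_iff hp hq False

/-! ### Sparse graphs contain a reducible configuration -/

section Sparse

variable {V : Type*} (G : SimpleGraph V)

/-- The number of neighbors of `v` in `s`. -/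
noncomputable def degreeWithin (s : Finset V) (v : V) : ℕ :=
  open Classical in (s.filter (G.Adj v)).card

lemma exists_leaf_or_adjacent_pair {s : Finset V}
    (h : 5 * ∑ v ∈ s, G.degreeWithin s v < 12 * s.card) :
    (∃ v ∈ s, G.degreeWithin s v ≤ 1) ∨
      ∃ a ∈ s, ∃ b ∈ s, G.Adj a b ∧ G.degreeWithin s a ≤ 2 ∧ G.degreeWithin s b ≤ 2 := by
  classical
  by_contra! hcon
  obtain ⟨h2, hadj⟩ := hcon
  set A := s.filter fun v => G.degreeWithin s v ≤ 2 with hA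
  set B := s.filter fun v => ¬ G.degreeWithin s v ≤ 2 with hB
  have hcard : A.card + B.card = s.card := Finset.card_filter_add_card_filter_not _
  have hsum : ∑ v ∈ A, G.degreeWithin s v + ∑ v ∈ B, G.degreeWithin s v
      = ∑ v ∈ s, G.degreeWithin s v := Finset.sum_filter_add_sum_filter_not _ _ _
  have hAlow : 2 * A.card ≤ ∑ v ∈ A, G.degreeWithin s v := by
    rw [mul_comm, ← smul_eq_mul]
    exact Finset.card_nsmul_le_sum _ _ _ fun v hv => h2 v (Finset.mem_filter.1 hv).1
  have hBlow : 3 * B.card ≤ ∑ v ∈ B, G.degreeWithin s v := by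
    rw [mul_comm, ← smul_eq_mul]
    exact Finset.card_nsmul_le_sum _ _ _ fun v hv => by
      have := (Finset.mem_filter.1 hv).2
      omega
  -- every edge that meets `A` has its other end in `B`
  have hAB : ∑ v ∈ A, G.degreeWithin s v ≤ ∑ v ∈ B, G.degreeWithin s v := by
    calc ∑ v ∈ A, G.degreeWithin s v = ∑ v ∈ A, (B.filter (G.Adj v)).card := by
          refine Finset.sum_congr rfl fun v hv => ?_
          obtain ⟨hvs, hv2⟩ := Finset.mem_filter.1 hv
          unfold degreeWithin
          congr 1
          ext w
          simp only [hB, Finset.mem_filter]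
          constructor
          · rintro ⟨hw, hvw⟩
            have := hadj v hvs w hw hvw hv2
            exact ⟨⟨hw, by omega⟩, hvw⟩
          · rintro ⟨⟨hw, -⟩, hvw⟩
            exact ⟨hw, hvw⟩
      _ = ∑ w ∈ B, (A.filter fun v => G.Adj v w).card :=
          Finset.sum_card_bipartiteAbove_eq_sum_card_bipartiteBelow _
      _ ≤ ∑ w ∈ B, G.degreeWithin s w := by
          refine Finset.sum_le_sum fun w _ => Finset.card_le_card fun v hv => ?_
          obtain ⟨hv, hvw⟩ := Finset.mem_filter.1 hv
          exact Finset.mem_filter.2 ⟨(Finset.mem_filter.1 hv).1, hvw.symm⟩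
  omega

variable [Finite V]

lemma sum_degreeWithin_le (s : Finset V) :
    ((∑ v ∈ s, G.degreeWithin s v : ℕ) : ℝ) ≤ G.maximumAverageDegree * s.card := by
  classical
  rcases s.eq_empty_or_nonempty with rfl | hs
  · simp
  let H : G.Subgraph := (⊤ : G.Subgraph).induce (s : Set V)
  have hle : H.averageDegree ≤ G.maximumAverageDegree :=
    le_csSup (((Set.finite_range fun K : G.Subgraph => K.averageDegree).subset
      (by rintro _ ⟨K, -, rfl⟩; exact ⟨K, rfl⟩)).bddAbove) ⟨H, hs, rfl⟩
  have hdeg (v : V) (hv : v ∈ s) : (H.neighborSet v).ncard = G.degreeWithin s v := by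
    unfold degreeWithin
    rw [← Set.ncard_coe_finset]
    congr 1
    ext w
    simp [H, hv]
  have havg : H.averageDegree = ((∑ v ∈ s, G.degreeWithin s v : ℕ) : ℝ) / s.card := by
    have hverts : H.verts = (s : Set V) := rfl
    unfold Subgraph.averageDegree
    rw [finsum_set_coe_eq_finsum_mem (f := fun v => ((H.neighborSet v).ncard : ℝ)), hverts,
      finsum_mem_coe_finset, Set.ncard_coe_finset, Nat.cast_sum]
    congr 1
    exact Finset.sum_congr rfl fun v hv => by rw [hdeg v hv]
  rwa [havg, div_le_iff₀ (by exact_mod_cast hs.card_pos)] at hle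

end Sparse

/-! ### Extending representations -/

/-- `I` realises on `s` the labeling whose near edges are those in the relation `L`, with all
values in the window. -/
def IsWindowRep {V : Type*} (G : SimpleGraph V) (L : V → V → Prop) (s : Finset V) (I : V → ℝ) :
    Prop :=
  (∀ v, I v ∈ window) ∧ ∀ u ∈ s, ∀ v ∈ s, G.Adj u v → (|I u - I v| ≤ 1 ↔ L u v)

section Extend

variable {V : Type*} {G : SimpleGraph V} {L : V → V → Prop} {s : Finset V} {I : V → ℝ}

lemma IsWindowRep.extend_leaf [DecidableEq V] (hL : ∀ u v, L u v ↔ L v u) {v : V}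
    (hI : G.IsWindowRep L (s.erase v) I) (hv : G.degreeWithin s v ≤ 1) :
    ∃ I', G.IsWindowRep L s I' := by
  classical
  have : Nonempty V := ⟨v⟩
  obtain ⟨w, hw⟩ := Finset.card_le_one_iff_subset_singleton.1 hv
  replace hw (u : V) (hu : u ∈ s) (h : G.Adj v u) : u = w :=
    Finset.mem_singleton.1 (hw (Finset.mem_filter.2 ⟨hu, h⟩))
  obtain ⟨a, ha, haw⟩ := exists_mem_window_near_iff (hI.1 w) (L w v)
  have key (x : V) (hx : x ∈ s) (h : G.Adj v x) : |I x - a| ≤ 1 ↔ L x v := by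
    rw [hw x hx h, haw]
  refine ⟨Function.update I v a, fun x => ?_, fun x hx y hy hxy => ?_⟩
  · by_cases h : x = v
    · simpa [h] using ha
    · simpa [h] using hI.1 x
  by_cases h1 : x = v
  · subst h1
    rw [Function.update_self, Function.update_of_ne hxy.ne', abs_sub_comm, hL]
    exact key y hy hxy
  by_cases h2 : y = v
  · subst h2
    rw [Function.update_self, Function.update_of_ne h1]
    exact key x hx hxy.symm
  rw [Function.update_of_ne h1, Function.update_of_ne h2]
  exact hI.2 x (Finset.mem_erase.2 ⟨h1, hx⟩) y (Finset.mem_erase.2 ⟨h2, hy⟩) hxy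

/-- A vertex of degree at most `2` has at most one neighbor besides a given one. -/
lemma exists_other_neighbor {a b : V} (hb : b ∈ s) (hab : G.Adj a b)
    (ha : G.degreeWithin s a ≤ 2) : ∃ p, ∀ u ∈ s, G.Adj a u → u ≠ b → u = p := by
  classical
  have : Nonempty V := ⟨a⟩
  have hmem : b ∈ s.filter (G.Adj a) := Finset.mem_filter.2 ⟨hb, hab⟩
  have hcard : ((s.filter (G.Adj a)).erase b).card ≤ 1 := by
    rw [Finset.card_erase_of_mem hmem]
    unfold degreeWithin at ha
    omega
  obtain ⟨p, hp⟩ := Finset.card_le_one_iff_subset_singleton.1 hcard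
  exact ⟨p, fun u hu h hne => by
    simpa using hp (Finset.mem_erase.2 ⟨hne, Finset.mem_filter.2 ⟨hu, h⟩⟩)⟩

lemma IsWindowRep.extend_pair [DecidableEq V] (hL : ∀ u v, L u v ↔ L v u) {a b : V}
    (hI : G.IsWindowRep L ((s.erase a).erase b) I) (ha : a ∈ s) (hb : b ∈ s) (hab : G.Adj a b)
    (ha2 : G.degreeWithin s a ≤ 2) (hb2 : G.degreeWithin s b ≤ 2) :
    ∃ I', G.IsWindowRep L s I' := by
  obtain ⟨p, hp⟩ := exists_other_neighbor hb hab ha2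
  obtain ⟨q, hq⟩ := exists_other_neighbor ha hab.symm hb2
  obtain ⟨α, hα, β, hβ, h1, h2, h3⟩ :=
    exists_mem_window_thread (hI.1 p) (hI.1 q) (L p a) (L a b) (L b q)
  have keya (x : V) (hx : x ∈ s) (h : G.Adj a x) (hne : x ≠ b) : |I x - α| ≤ 1 ↔ L x a := by
    rw [hp x hx h hne, h1]
  have keyb (x : V) (hx : x ∈ s) (h : G.Adj b x) (hne : x ≠ a) : |I x - β| ≤ 1 ↔ L x b := by
    rw [hq x hx h hne, abs_sub_comm, h3, hL]
  let J := Function.update (Function.update I a α) b β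
  have hJb : J b = β := Function.update_self ..
  have hJa : J a = α := by simp [J, hab.ne]
  have hJ (x : V) (hxa : x ≠ a) (hxb : x ≠ b) : J x = I x := by simp [J, hxa, hxb]
  -- the condition is symmetric, which leaves four kinds of edges
  have hsymm (x y : V) (h : |J x - J y| ≤ 1 ↔ L x y) : |J y - J x| ≤ 1 ↔ L y x := by
    rwa [abs_sub_comm, hL]
  have hedgea (x : V) (hx : x ∈ s) (h : G.Adj a x) : |J x - J a| ≤ 1 ↔ L x a := by
    by_cases hxb : x = b
    · subst hxb
      rw [hJa, hJb, abs_sub_comm, h2, hL]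
    · rw [hJ x h.ne' hxb, hJa]
      exact keya x hx h hxb
  have hedgeb (x : V) (hx : x ∈ s) (h : G.Adj b x) : |J x - J b| ≤ 1 ↔ L x b := by
    by_cases hxa : x = a
    · subst hxa
      rw [hJa, hJb, h2]
    · rw [hJ x hxa h.ne', hJb]
      exact keyb x hx h hxa
  refine ⟨J, fun x => ?_, fun x hx y hy hxy => ?_⟩
  · by_cases hxb : x = b
    · rwa [hxb, hJb]
    by_cases hxa : x = a
    · rwa [hxa, hJa]
    rw [hJ x hxa hxb]
    exact hI.1 x
  by_cases hxa : x = a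
  · subst hxa
    exact hsymm _ _ (hedgea y hy hxy)
  by_cases hxb : x = b
  · subst hxb
    exact hsymm _ _ (hedgeb y hy hxy)
  by_cases hya : y = a
  · subst hya
    exact hedgea x hx hxy.symm
  by_cases hyb : y = b
  · subst hyb
    exact hedgeb x hx hxy.symm
  rw [hJ x hxa hxb, hJ y hya hyb]
  exact hI.2 x (by simp [hxa, hxb, hx]) y (by simp [hya, hyb, hy]) hxy

lemma exists_isWindowRep (hL : ∀ u v, L u v ↔ L v u)
    (h : ∀ t : Finset V, t.Nonempty → 5 * ∑ v ∈ t, G.degreeWithin t v < 12 * t.card)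
    (s : Finset V) : ∃ I, G.IsWindowRep L s I := by
  classical
  induction s using Finset.strongInduction with
  | H s ih =>
    rcases s.eq_empty_or_nonempty with rfl | hs
    · exact ⟨fun _ => 0, fun _ => by norm_num [window], by simp⟩
    rcases G.exists_leaf_or_adjacent_pair (h s hs) with
      ⟨v, hv, hdeg⟩ | ⟨a, ha, b, hb, hab, h1, h2⟩
    · obtain ⟨I, hI⟩ := ih _ (Finset.erase_ssubset hv)
      exact hI.extend_leaf hL hdeg
    · obtain ⟨I, hI⟩ := ih ((s.erase a).erase b)
        ((Finset.erase_subset _ _).trans_ssubset (Finset.erase_ssubset ha))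
      exact hI.extend_pair hL ha hb hab h1 h2

end Extend

end SimpleGraph

open SimpleGraph in
theorem mainTheorem4 {V : Type*} [Finite V] (G : SimpleGraph V) (hplanar : G.IsPlanar)
    (hmad : G.maximumAverageDegree < 26 / 11) : G.IsWeakUnitIntervalGraph := by
  intro ℓ
  have := Fintype.ofFinite V
  obtain ⟨I, -, hI⟩ := exists_isWindowRep (G := G)
    (L := fun u v => ∃ h : G.Adj u v, ℓ.get u v h = NearFar.near)
    (fun u v => ⟨fun ⟨h, e⟩ => ⟨h.symm, by rwa [EdgeLabeling.get_comm]⟩,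
      fun ⟨h, e⟩ => ⟨h.symm, by rwa [EdgeLabeling.get_comm]⟩⟩)
    (fun t ht => by
      have h1 := G.sum_degreeWithin_le t
      have h2 : (0 : ℝ) < t.card := by exact_mod_cast ht.card_pos
      have h3 : (5 : ℝ) * (∑ v ∈ t, G.degreeWithin t v : ℕ) < 12 * t.card := by nlinarith
      exact_mod_cast h3)
    Finset.univ
  refine ⟨I, fun u v huv => ?_⟩
  rw [hI u (Finset.mem_univ u) v (Finset.mem_univ v) huv]
  exact ⟨fun ⟨_, e⟩ => e, fun e => ⟨huv, e⟩⟩
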